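/- Let $\mathfrak H$ be a complex Hilbert space with inner product $(\cdot,\cdot)$, and let $a$ and $b$ be positive, selfadjoint (not necessarily bounded) operators in $\mathfrak H$ such that $\mathrm{dom}\,a^{1/2}\cap\mathrm{dom}\,b^{1/2}$ is dense in $\mathfrak H$. On $\mathrm{ran}\,a$ the formula $\langle ax,ay\rangle_a=(ax,y)$ $(x,y\in\mathrm{dom}\,a)$ defines an inner product; let $\mathfrak H_a$ be the completion of this pre-Hilbert space, and define $\mathfrak H_b$ likewise from $b$. Let $J:\mathfrak H_a\oplus\mathfrak H_b\to\mathfrak H$ be the densely defined operator with $$\mathrm{dom}\,J=\mathrm{ran}\,a\oplus\mathrm{ran}\,b,\qquad J(ax\oplus by)=ax+by\quad(x\in\mathrm{dom}\,a,\ y\in\mathrm{dom}\,b).$$ Let $a\stackrel{.}{+}b$ denote the form sum of $a$ and $b$, i.e. the operator associated with the closed form $q(x,y)=(a^{1/2}x,a^{1/2}y)+(b^{1/2}x,b^{1/2}y)$ on $\mathrm{dom}\,q=\mathrm{dom}\,a^{1/2}\cap\mathrm{dom}\,b^{1/2}$: a vector $x$ belongs to $\mathrm{dom}(a\stackrel{.}{+}b)$,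 with $(a\stackrel{.}{+}b)x=z$, if and only if $x\in\mathrm{dom}\,q$ and $q(x,y)=(z,y)$ for all $y\in\mathrm{dom}\,q$. Then $a\stackrel{.}{+}b$ is a positive, selfadjoint operator, and $$J^{**}J^{*}=a\stackrel{.}{+}b,$$ where $J^{**}J^*$ has its natural domain $\{x\in\mathrm{dom}\,J^*: J^*x\in\mathrm{dom}\,J^{**}\}$. -/

import Mathlib

namespace FormSum

noncomputable section

open scoped ComplexConjugate LinearPMap

variable {H : Type*} [NormedAddCommGroup H] [InnerProductSpace ℂ H]

/-! ### Unbounded operators -/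

/-- The product `g f` of two unbounded operators on its natural domain
`{x ∈ dom f | f x ∈ dom g}`. -/
def opComp {E F G : Type*} [AddCommGroup E] [Module ℂ E] [AddCommGroup F] [Module ℂ F]
    [AddCommGroup G] [Module ℂ G] (g : F →ₗ.[ℂ] G) (f : E →ₗ.[ℂ] F) : E →ₗ.[ℂ] G :=
  g.comp (f.domRestrict ((g.domain.comap f.toFun).map f.domain.subtype)) (by
    intro x
    obtain ⟨y, hy, hyx⟩ := Submodule.mem_map.mp x.2.1
    rw [LinearPMap.domRestrict_apply (x := x) (y := y) hyx.symm]
    exact hy)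

theorem mem_opComp_domain {E F G : Type*} [AddCommGroup E] [Module ℂ E] [AddCommGroup F]
    [Module ℂ F] [AddCommGroup G] [Module ℂ G] (g : F →ₗ.[ℂ] G) (f : E →ₗ.[ℂ] F) (x : E) :
    x ∈ (opComp g f).domain ↔ ∃ hx : x ∈ f.domain, f ⟨x, hx⟩ ∈ g.domain := by
  constructor
  · rintro ⟨⟨y, hy, rfl⟩, hx⟩
    exact ⟨y.2, hy⟩
  · rintro ⟨hx, hfx⟩
    exact ⟨⟨⟨x, hx⟩, hfx, rfl⟩, hx⟩

theorem opComp_apply {E F G : Type*} [AddCommGroup E] [Module ℂ E] [AddCommGroup F]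
    [Module ℂ F] [AddCommGroup G] [Module ℂ G] (g : F →ₗ.[ℂ] G) (f : E →ₗ.[ℂ] F)
    (x : (opComp g f).domain) (hx : (x : E) ∈ f.domain) (hfx : f ⟨x, hx⟩ ∈ g.domain) :
    opComp g f x = g ⟨f ⟨x, hx⟩, hfx⟩ := rfl

/-- A positive, symmetric operator, with not necessarily dense domain. -/
structure IsPosSymmetric (a : H →ₗ.[ℂ] H) : Prop where
  symm : ∀ x y : a.domain, inner ℂ (a x) (y : H) = inner ℂ (x : H) (a y)
  nonneg : ∀ x : a.domain, 0 ≤ (inner ℂ (a x) (x : H)).re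

/-- A positive, selfadjoint operator. (Selfadjointness of a partially defined operator entails
that its domain is dense.) -/
structure IsPosSelfAdjoint [CompleteSpace H] (a : H →ₗ.[ℂ] H) : Prop where
  selfAdjoint : IsSelfAdjoint a
  nonneg : ∀ x : a.domain, 0 ≤ (inner ℂ (a x) (x : H)).re

theorem IsPosSelfAdjoint.isPosSymmetric [CompleteSpace H] {a : H →ₗ.[ℂ] H}
    (ha : IsPosSelfAdjoint a) : IsPosSymmetric a where
  symm := by
    have h := LinearPMap.adjoint_isFormalAdjoint ha.selfAdjoint.dense_domain
    rw [LinearPMap.isSelfAdjoint_def.mp ha.selfAdjoint] at h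
    exact h
  nonneg := ha.nonneg

/-- `s` is a positive selfadjoint square root of `a`. -/
structure IsPosSqrt [CompleteSpace H] (s a : H →ₗ.[ℂ] H) : Prop where
  posSelfAdjoint : IsPosSelfAdjoint s
  sq : opComp s s = a

open scoped Classical in
/-- The positive square root `a^{1/2}`: the (unique) positive selfadjoint operator whose square is
`a`; it exists for every positive selfadjoint `a`. -/
def opSqrt [CompleteSpace H] (a : H →ₗ.[ℂ] H) : H →ₗ.[ℂ] H :=
  if h : ∃ s, IsPosSqrt s a then h.choose else 0

/-! ### The classical form sum -/

/-- The operator associated with a sesquilinear form `t` on a dense subspace `D` of `H`: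
`x ∈ D` belongs to its domain and is mapped to `z` iff `t x y = ⟪z, y⟫` for all `y ∈ D`. -/
def formOperator (D : Submodule ℂ H) (t : D →ₗ⋆[ℂ] D →ₗ[ℂ] ℂ) : H →ₗ.[ℂ] H :=
  Submodule.toLinearPMap
    { carrier := {p : H × H | ∃ hx : p.1 ∈ D, ∀ y : D, t ⟨p.1, hx⟩ y = inner ℂ p.2 (y : H)}
      zero_mem' := ⟨D.zero_mem, fun y => by
        rw [show (⟨(0 : H × H).1, D.zero_mem⟩ : D) = 0 from rfl]; simp⟩
      add_mem' := by
        rintro ⟨x, z⟩ ⟨x', z'⟩ ⟨hx, h⟩ ⟨hx', h'⟩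
        refine ⟨D.add_mem hx hx', fun y => ?_⟩
        have e : (⟨((x, z) + (x', z')).1, D.add_mem hx hx'⟩ : D) = ⟨x, hx⟩ + ⟨x', hx'⟩ := rfl
        rw [e, map_add, LinearMap.add_apply, Prod.snd_add, inner_add_left]
        exact congrArg₂ (· + ·) (h y) (h' y)
      smul_mem' := by
        rintro c ⟨x, z⟩ ⟨hx, h⟩
        refine ⟨D.smul_mem c hx, fun y => ?_⟩
        have e : (⟨(c • (x, z)).1, D.smul_mem c hx⟩ : D) = c • ⟨x, hx⟩ := rfl
        rw [e, LinearMap.map_smulₛₗ, LinearMap.smul_apply, Prod.smul_snd, inner_smul_left,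
          smul_eq_mul]
        exact congrArg (conj c * ·) (h y) }

theorem mem_formOperator_graph (D : Submodule ℂ H) (t : D →ₗ⋆[ℂ] D →ₗ[ℂ] ℂ)
    (hD : Dense (D : Set H)) (x z : H) :
    (x, z) ∈ (formOperator D t).graph ↔
      ∃ hx : x ∈ D, ∀ y : D, t ⟨x, hx⟩ y = inner ℂ z (y : H) := by
  rw [formOperator, Submodule.toLinearPMap_graph_eq]
  · rfl
  · rintro ⟨x, z⟩ ⟨hx, h⟩ rfl
    refine hD.eq_zero_of_inner_left ℂ fun y hy => ?_
    rw [← h ⟨y, hy⟩, show (⟨((0 : H), z).1, hx⟩ : D) = 0 from rfl, map_zero,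
      LinearMap.zero_apply]

/-- The closed form of a positive selfadjoint operator given by its square root `s`, restricted to
a subspace `D` of `dom s`: `(x, y) ↦ ⟪s x, s y⟫`. -/
def sqrtForm (s : H →ₗ.[ℂ] H) (D : Submodule ℂ H) (hD : D ≤ s.domain) :
    D →ₗ⋆[ℂ] D →ₗ[ℂ] ℂ :=
  ((innerₛₗ ℂ).comp (s.toFun ∘ₗ Submodule.inclusion hD)).compl₂ (s.toFun ∘ₗ Submodule.inclusion hD)

theorem sqrtForm_apply (s : H →ₗ.[ℂ] H) (D : Submodule ℂ H) (hD : D ≤ s.domain) (x y : D) :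
    sqrtForm s D hD x y = inner ℂ (s ⟨x, hD x.2⟩) (s ⟨y, hD y.2⟩) := rfl

/-- The form sum of `a` and `b`: the operator associated with the form
`⟪a^{1/2} x, a^{1/2} y⟫ + ⟪b^{1/2} x, b^{1/2} y⟫` on `dom a^{1/2} ∩ dom b^{1/2}`. -/
def formSum [CompleteSpace H] (a b : H →ₗ.[ℂ] H) : H →ₗ.[ℂ] H :=
  formOperator ((opSqrt a).domain ⊓ (opSqrt b).domain)
    (sqrtForm (opSqrt a) _ inf_le_left + sqrtForm (opSqrt b) _ inf_le_right)

/-! ### The auxiliary Hilbert space of a positive symmetric operator -/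

/-- The form domain
`D_*(a) = {y | ∃ m, ∀ x ∈ dom a, |(a x, y)|² ≤ m (a x, x)}`. -/
def formDomain (a : H →ₗ.[ℂ] H) : Set H :=
  {y | ∃ m : ℝ, ∀ x : a.domain, ‖inner ℂ (a x) y‖ ^ 2 ≤ m * (inner ℂ (a x) (x : H)).re}

/-- The operators to which the construction applies: positive symmetric operators with dense form
domain. -/
structure IsAdmissible (a : H →ₗ.[ℂ] H) : Prop where
  posSymmetric : IsPosSymmetric a
  dense : Dense (formDomain a)

/-- The vector space `ran a`, to be equipped with the inner product `⟨a x, a y⟩ = (a x, y)`. -/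
def Ran (a : H →ₗ.[ℂ] H) (_ha : IsAdmissible a) : Type _ := LinearMap.range a.toFun

namespace Ran

variable {a : H →ₗ.[ℂ] H} (ha : IsAdmissible a)

instance : AddCommGroup (Ran a ha) := inferInstanceAs (AddCommGroup (LinearMap.range a.toFun))

instance : Module ℂ (Ran a ha) := inferInstanceAs (Module ℂ (LinearMap.range a.toFun))

/-- The inclusion of `ran a` into `H`. -/
def incl : Ran a ha →ₗ[ℂ] H := (LinearMap.range a.toFun).subtype

theorem incl_injective : Function.Injective (incl ha) := Subtype.val_injective

/-- The element `a x` of `ran a`. -/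
def of : a.domain →ₗ[ℂ] Ran a ha := a.toFun.rangeRestrict

theorem incl_of (x : a.domain) : incl ha (of ha x) = a x := rfl

/-- Some preimage of an element of `ran a`. -/
def preim (p : Ran a ha) : a.domain := p.2.choose

theorem map_preim (p : Ran a ha) : a (preim ha p) = incl ha p := p.2.choose_spec

/-- The inner product `⟨a x, a y⟩ = (a x, y)` on `ran a` (see `inner_of`). -/
abbrev core : InnerProductSpace.Core ℂ (Ran a ha) where
  inner p q := inner ℂ (incl ha p) (preim ha q : H)
  conj_inner_symm p q := by
    rw [inner_conj_symm, ← map_preim, ← map_preim, ha.posSymmetric.symm]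
  re_inner_nonneg p := by
    rw [← map_preim]
    exact ha.posSymmetric.nonneg _
  add_left p q r := by rw [map_add, inner_add_left]
  smul_left p q c := by rw [map_smul, inner_smul_left]
  definite p hp := by
    rw [← map_preim] at hp
    apply incl_injective ha
    rw [map_zero]
    refine ha.dense.eq_zero_of_inner_left ℂ fun y hy => ?_
    obtain ⟨m, hm⟩ := hy
    have h := hm (preim ha p)
    rw [hp, Complex.zero_re, mul_zero, map_preim] at h
    exact norm_eq_zero.mp (pow_eq_zero_iff two_ne_zero |>.mp (le_antisymm h (sq_nonneg _)))

instance : NormedAddCommGroup (Ran a ha) := (core ha).toNormedAddCommGroup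

instance : InnerProductSpace ℂ (Ran a ha) := InnerProductSpace.ofCore (core ha).toCore

theorem inner_of (x y : a.domain) :
    inner ℂ (of ha x) (of ha y) = inner ℂ (a x) (y : H) := by
  change inner ℂ (a x) (preim ha (of ha y) : H) = _
  rw [ha.posSymmetric.symm, map_preim, incl_of, ha.posSymmetric.symm]

end Ran

/-- The Hilbert space `H_a`, the completion of `ran a`. -/
abbrev HilbertRan (a : H →ₗ.[ℂ] H) (ha : IsAdmissible a) : Type _ :=
  UniformSpace.Completion (Ran a ha)

variable {a b : H →ₗ.[ℂ] H}

/-- The embedding of `ran a ⊕ ran b` into the Hilbert space direct sum `H_a ⊕ H_b`. -/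
def sumEmb (ha : IsAdmissible a) (hb : IsAdmissible b) :
    Ran a ha × Ran b hb →ₗ[ℂ] WithLp 2 (HilbertRan a ha × HilbertRan b hb) :=
  (WithLp.linearEquiv 2 ℂ (HilbertRan a ha × HilbertRan b hb)).symm.toLinearMap ∘ₗ
    LinearMap.prodMap
      (UniformSpace.Completion.toComplₗᵢ (𝕜 := ℂ) (E := Ran a ha)).toLinearMap
      (UniformSpace.Completion.toComplₗᵢ (𝕜 := ℂ) (E := Ran b hb)).toLinearMap

theorem sumEmb_apply (ha : IsAdmissible a) (hb : IsAdmissible b) (p : Ran a ha) (q : Ran b hb) :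
    sumEmb ha hb (p, q) =
      WithLp.toLp 2 ((p : HilbertRan a ha), (q : HilbertRan b hb)) := rfl

theorem sumEmb_injective (ha : IsAdmissible a) (hb : IsAdmissible b) :
    Function.Injective (sumEmb ha hb) :=
  (WithLp.linearEquiv 2 ℂ (HilbertRan a ha × HilbertRan b hb)).symm.injective.comp
    ((UniformSpace.Completion.toComplₗᵢ (𝕜 := ℂ) (E := Ran a ha)).injective.prodMap
      (UniformSpace.Completion.toComplₗᵢ (𝕜 := ℂ) (E := Ran b hb)).injective)

/-- The operator `J : H_a ⊕ H_b → H` with domain `ran a ⊕ ran b` and `J (a x ⊕ b y) = a x + b y`. -/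
def opJ (ha : IsAdmissible a) (hb : IsAdmissible b) :
    WithLp 2 (HilbertRan a ha × HilbertRan b hb) →ₗ.[ℂ] H where
  domain := LinearMap.range (sumEmb ha hb)
  toFun := (LinearMap.coprod (Ran.incl ha) (Ran.incl hb)) ∘ₗ
    (LinearEquiv.ofInjective (sumEmb ha hb) (sumEmb_injective ha hb)).symm.toLinearMap

theorem opJ_apply (ha : IsAdmissible a) (hb : IsAdmissible b) (x : a.domain) (y : b.domain) :
    opJ ha hb ⟨sumEmb ha hb (Ran.of ha x, Ran.of hb y), LinearMap.mem_range_self _ _⟩ =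
      a x + b y := by
  change (LinearMap.coprod (Ran.incl ha) (Ran.incl hb))
    ((LinearEquiv.ofInjective (sumEmb ha hb) (sumEmb_injective ha hb)).symm
      ((LinearEquiv.ofInjective (sumEmb ha hb) (sumEmb_injective ha hb))
        (Ran.of ha x, Ran.of hb y))) = _
  rw [LinearEquiv.symm_apply_apply, LinearMap.coprod_apply, Ran.incl_of, Ran.incl_of]

/-- The operator `J** J*`. -/
def opJJ [CompleteSpace H] (ha : IsAdmissible a) (hb : IsAdmissible b) : H →ₗ.[ℂ] H :=
  opComp (opJ ha hb)†† (opJ ha hb)†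

/-! ### Positive selfadjoint operators are admissible -/

theorem IsPosSymmetric.domain_subset_formDomain (ha : IsPosSymmetric a) :
    (a.domain : Set H) ⊆ formDomain a := by
  intro y hy
  let c : PreInnerProductSpace.Core ℂ a.domain :=
    { inner := fun u v => inner ℂ (a u) (v : H)
      conj_inner_symm := fun u v => by rw [inner_conj_symm, ha.symm]
      re_inner_nonneg := fun u => ha.nonneg u
      add_left := fun u v w => by rw [LinearPMap.map_add, inner_add_left]
      smul_left := fun u v r => by rw [LinearPMap.map_smul, inner_smul_left] }
  refine ⟨(inner ℂ (a ⟨y, hy⟩) y).re, fun x => ?_⟩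
  have h := InnerProductSpace.Core.inner_mul_inner_self_le (𝕜 := ℂ) (c := c) x ⟨y, hy⟩
  have h' : ‖inner ℂ (a x) y‖ * ‖inner ℂ (a ⟨y, hy⟩) (x : H)‖ ≤
      (inner ℂ (a x) (x : H)).re * (inner ℂ (a ⟨y, hy⟩) y).re := h
  rw [ha.symm ⟨y, hy⟩ x, norm_inner_symm y (a x)] at h'
  rw [sq, mul_comm (inner ℂ (a ⟨y, hy⟩) y).re]
  exact h'

theorem IsPosSelfAdjoint.isAdmissible [CompleteSpace H] (ha : IsPosSelfAdjoint a) :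
    IsAdmissible a where
  posSymmetric := ha.isPosSymmetric
  dense := ha.selfAdjoint.dense_domain.mono ha.isPosSymmetric.domain_subset_formDomain

end

end FormSum

/-!
For a factorization `a = T* T` with `T` closed and densely defined, `a x ↦ T x` extends to an
isometry `V` of `H_a` into the range space of `T`, because `⟪a x, a y⟫_a = (a x, y) = (T x, T y)`.
A vector `u` of `H_a` satisfies `⟪u, a y⟫_a = (x, a y)` for all `y ∈ dom a` iff `x ∈ dom T` and
`V u = T x`: since `1 + T* T` is surjective, `dom a` is a core of `T`.

Applied to `T = a^{1/2}` and `T = b^{1/2}`, this computes `J*`: its domain is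
`dom a^{1/2} ∩ dom b^{1/2}`, and `(J* x, J* y) = (a^{1/2} x, a^{1/2} y) + (b^{1/2} x, b^{1/2} y)`.
Hence the operator associated with the form on the right is `(J*)* J*`, which is positive and
selfadjoint by von Neumann's theorem, `J*` being closed and densely defined.

The square root of `a` is `(1 - R)^{1/2} R^{-1/2}`, where `R = (1 + a)⁻¹` is bounded and
`0 ≤ R ≤ 1`.
-/

namespace FormSum

noncomputable section

open scoped InnerProductSpace LinearPMap

section Graph

variable {𝕜 E F : Type*} [RCLike 𝕜] [NormedAddCommGroup E] [InnerProductSpace 𝕜 E]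
  [CompleteSpace E] [NormedAddCommGroup F] [InnerProductSpace 𝕜 F] {T : E →ₗ.[𝕜] F}

theorem mem_adjoint_graph_iff (hT : Dense (T.domain : Set E)) (y : F) (z : E) :
    (y, z) ∈ T†.graph ↔ ∀ x : T.domain, ⟪z, (x : E)⟫_𝕜 = ⟪y, T x⟫_𝕜 := by
  rw [LinearPMap.mem_graph_iff]
  constructor
  · rintro ⟨y, rfl, rfl⟩
    exact LinearPMap.adjoint_isFormalAdjoint hT y
  · intro h
    exact ⟨⟨y, LinearPMap.mem_adjoint_domain_of_exists y ⟨z, h⟩⟩, rfl,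
      LinearPMap.adjoint_apply_eq hT _ h⟩

/- `(p, T p)` is the orthogonal projection of `(u, v)` onto the graph of `T`. -/
theorem exists_inner_sub_add_inner_sub_eq_zero [CompleteSpace F] (hT : T.IsClosed) (u : E)
    (v : F) :
    ∃ p : T.domain, ∀ y : T.domain, ⟪u - p, (y : E)⟫_𝕜 + ⟪v - T p, T y⟫_𝕜 = 0 := by
  let G : Submodule 𝕜 (WithLp 2 (E × F)) :=
    T.graph.comap (WithLp.linearEquiv 2 𝕜 (E × F)).toLinearMap
  have hG : IsClosed (G : Set (WithLp 2 (E × F))) :=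
    IsClosed.preimage (WithLp.prod_continuous_ofLp 2 E F) hT
  have : CompleteSpace G := hG.completeSpace_coe
  have hproj := G.starProjection_apply_mem (WithLp.toLp 2 (u, v))
  obtain ⟨p, hp, hTp⟩ := T.mem_graph_iff.mp hproj
  refine ⟨p, fun y => ?_⟩
  rw [hp, hTp]
  exact G.starProjection_inner_eq_zero (WithLp.toLp 2 (u, v)) (WithLp.toLp 2 ((y : E), T y))
    (T.mem_graph y)

end Graph

theorem mem_opComp_graph {E F G : Type*} [AddCommGroup E] [Module ℂ E] [AddCommGroup F]
    [Module ℂ F] [AddCommGroup G] [Module ℂ G] {g : F →ₗ.[ℂ] G} {f : E →ₗ.[ℂ] F} {x : E} {z : G} :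
    (x, z) ∈ (opComp g f).graph ↔ ∃ y, (x, y) ∈ f.graph ∧ (y, z) ∈ g.graph := by
  simp only [LinearPMap.mem_graph_iff]
  constructor
  · rintro ⟨x, rfl, rfl⟩
    obtain ⟨hx, hfx⟩ := (mem_opComp_domain g f x).mp x.2
    exact ⟨f ⟨x, hx⟩, ⟨⟨x, hx⟩, rfl, rfl⟩, ⟨f ⟨x, hx⟩, hfx⟩, rfl, rfl⟩
  · rintro ⟨_, ⟨x, rfl, rfl⟩, ⟨y, hfx⟩, rfl, rfl⟩
    exact ⟨⟨x, (mem_opComp_domain g f x).mpr ⟨x.2, hfx⟩⟩, rfl, rfl⟩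

section OneAdd

variable {R E : Type*} [Ring R] [AddCommGroup E] [Module R E] (a : E →ₗ.[R] E)

/-- The map `1 + a : dom a → E`. It is bijective if `a` is positive and selfadjoint, and its
inverse is then the resolvent of `a`. -/
def oneAdd : a.domain →ₗ[R] E :=
  a.domain.subtype + a.toFun

theorem oneAdd_apply (x : a.domain) : oneAdd a x = x + a x := rfl

end OneAdd

variable {H : Type*} [NormedAddCommGroup H] [InnerProductSpace ℂ H]
  {K : Type*} [NormedAddCommGroup K] [InnerProductSpace ℂ K] {a b : H →ₗ.[ℂ] H}

namespace IsPosSymmetric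

theorem norm_sq_add_norm_sq_le (ha : IsPosSymmetric a) (x : a.domain) :
    ‖(x : H)‖ ^ 2 + ‖a x‖ ^ 2 ≤ ‖oneAdd a x‖ ^ 2 := by
  have hnonneg : 0 ≤ RCLike.re ⟪(x : H), a x⟫_ℂ := by
    rw [← ha.symm]
    exact ha.nonneg x
  rw [oneAdd_apply, norm_add_sq (𝕜 := ℂ)]
  linarith

theorem norm_le_norm_oneAdd (ha : IsPosSymmetric a) (x : a.domain) :
    ‖(x : H)‖ ≤ ‖oneAdd a x‖ :=
  (sq_le_sq₀ (norm_nonneg _) (norm_nonneg _)).mp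
    (by linarith [ha.norm_sq_add_norm_sq_le x, sq_nonneg ‖a x‖])

theorem norm_apply_le_norm_oneAdd (ha : IsPosSymmetric a) (x : a.domain) :
    ‖a x‖ ≤ ‖oneAdd a x‖ :=
  (sq_le_sq₀ (norm_nonneg _) (norm_nonneg _)).mp
    (by linarith [ha.norm_sq_add_norm_sq_le x, sq_nonneg ‖(x : H)‖])

theorem oneAdd_injective (ha : IsPosSymmetric a) : Function.Injective (oneAdd a) := by
  rw [injective_iff_map_eq_zero]
  intro x hx
  have hle := ha.norm_le_norm_oneAdd x
  rw [hx, norm_zero, norm_le_zero_iff] at hle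
  exact Subtype.ext hle

theorem isClosed_range_oneAdd [CompleteSpace H] (ha : IsPosSymmetric a) (hcl : a.IsClosed) :
    IsClosed (LinearMap.range (oneAdd a) : Set H) := by
  let f : a.graph →L[ℂ] H :=
    (ContinuousLinearMap.fst ℂ H H + ContinuousLinearMap.snd ℂ H H).comp a.graph.subtypeL
  have hf (x : a.domain) : f ⟨(x, a x), a.mem_graph x⟩ = oneAdd a x := rfl
  have hrange : (LinearMap.range (oneAdd a) : Set H) = Set.range f := by
    ext z
    constructor
    · rintro ⟨x, rfl⟩
      exact ⟨_, hf x⟩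
    · rintro ⟨⟨_, hxy⟩, rfl⟩
      obtain ⟨x, rfl, rfl⟩ := (LinearPMap.mem_graph_iff' a).mp hxy
      exact ⟨x, rfl⟩
  have : CompleteSpace a.graph := hcl.completeSpace_coe
  have hanti : AntilipschitzWith 1 f := by
    refine AddMonoidHomClass.antilipschitz_of_bound f ?_
    rintro ⟨_, hxy⟩
    obtain ⟨x, rfl⟩ := (LinearPMap.mem_graph_iff' a).mp hxy
    rw [hf, NNReal.coe_one, one_mul]
    exact max_le (ha.norm_le_norm_oneAdd x) (ha.norm_apply_le_norm_oneAdd x)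
  rw [hrange]
  exact hanti.isClosed_range f.uniformContinuous

theorem dense_domain_of_oneAdd_surjective [CompleteSpace H] (ha : IsPosSymmetric a)
    (hsurj : Function.Surjective (oneAdd a)) : Dense (a.domain : Set H) := by
  rw [Submodule.dense_iff_topologicalClosure_eq_top, Submodule.topologicalClosure_eq_top_iff,
    Submodule.eq_bot_iff]
  intro y hy
  obtain ⟨x, rfl⟩ := hsurj y
  have horth : ⟪oneAdd a x, (x : H)⟫_ℂ = 0 := (Submodule.mem_orthogonal' _ _).mp hy x x.2
  have hx : (x : H) = 0 := by
    rw [oneAdd_apply, inner_add_left] at horth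
    rw [← re_inner_self_nonpos (𝕜 := ℂ)]
    have hre := congrArg Complex.re horth
    rw [Complex.add_re, Complex.zero_re] at hre
    change (⟪(x : H), (x : H)⟫_ℂ).re ≤ 0
    linarith [ha.nonneg x]
  rw [show x = 0 from Subtype.ext hx, map_zero]

theorem isPosSelfAdjoint_of_oneAdd_surjective [CompleteSpace H] (ha : IsPosSymmetric a)
    (hsurj : Function.Surjective (oneAdd a)) : IsPosSelfAdjoint a := by
  refine ⟨LinearPMap.isSelfAdjoint_def.mpr (LinearPMap.eq_of_eq_graph (Submodule.ext ?_)),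
    ha.nonneg⟩
  rintro ⟨y, z⟩
  rw [mem_adjoint_graph_iff (ha.dense_domain_of_oneAdd_surjective hsurj), LinearPMap.mem_graph_iff]
  constructor
  · intro h
    obtain ⟨x, hx⟩ := hsurj (y + z)
    have horth (w : a.domain) : ⟪(x : H) - y, oneAdd a w⟫_ℂ = 0 := calc
      ⟪(x : H) - y, oneAdd a w⟫_ℂ = ⟪oneAdd a x - (y + z), (w : H)⟫_ℂ := by
        simp only [oneAdd_apply, inner_sub_left, inner_add_left, inner_add_right, ha.symm, h]
        ring
      _ = 0 := by rw [hx, sub_self, inner_zero_left]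
    have hxy : (x : H) = y := by
      obtain ⟨w, hw⟩ := hsurj ((x : H) - y)
      rw [← sub_eq_zero, ← inner_self_eq_zero (𝕜 := ℂ)]
      simpa only [hw] using horth w
    exact ⟨x, hxy, by simpa only [oneAdd_apply, hxy, add_right_inj] using hx⟩
  · rintro ⟨x, rfl, rfl⟩
    exact ha.symm x

end IsPosSymmetric

section Factor

variable [CompleteSpace H]

/-- `T` is a closed, densely defined operator with `T* T = a`. Examples are `T = a^{1/2}`, and
`T = J*` with `a = J** J*`. -/
structure IsFactor (T : H →ₗ.[ℂ] K) (a : H →ₗ.[ℂ] H) : Prop where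
  isClosed : T.IsClosed
  dense_domain : Dense (T.domain : Set H)
  adjoint_comp_self : opComp T† T = a

namespace IsFactor

variable {T : H →ₗ.[ℂ] K}

theorem mem_graph_iff (h : IsFactor T a) {x z : H} :
    (x, z) ∈ a.graph ↔
      ∃ hx : x ∈ T.domain, ∀ y : T.domain, ⟪z, (y : H)⟫_ℂ = ⟪T ⟨x, hx⟩, T y⟫_ℂ := by
  simp only [← h.adjoint_comp_self, mem_opComp_graph, mem_adjoint_graph_iff h.dense_domain]
  constructor
  · rintro ⟨_, hxT, hz⟩
    obtain ⟨x, rfl, rfl⟩ := T.mem_graph_iff.mp hxT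
    exact ⟨x.2, hz⟩
  · rintro ⟨hx, hz⟩
    exact ⟨_, T.mem_graph ⟨x, hx⟩, hz⟩

theorem domain_le (h : IsFactor T a) : a.domain ≤ T.domain := fun x hx =>
  (h.mem_graph_iff.mp (a.mem_graph ⟨x, hx⟩)).1

theorem inner_apply (h : IsFactor T a) (x : a.domain) (y : T.domain) :
    ⟪a x, (y : H)⟫_ℂ = ⟪T ⟨x, h.domain_le x.2⟩, T y⟫_ℂ :=
  (h.mem_graph_iff.mp (a.mem_graph x)).2 y

theorem inner_apply' (h : IsFactor T a) (x : T.domain) (y : a.domain) :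
    ⟪(x : H), a y⟫_ℂ = ⟪T x, T ⟨y, h.domain_le y.2⟩⟫_ℂ := by
  rw [← inner_conj_symm, h.inner_apply, inner_conj_symm]

theorem isPosSymmetric (h : IsFactor T a) : IsPosSymmetric a where
  symm x y :=
    (h.inner_apply x ⟨y, h.domain_le y.2⟩).trans (h.inner_apply' ⟨x, h.domain_le x.2⟩ y).symm
  nonneg x := by
    rw [h.inner_apply x ⟨x, h.domain_le x.2⟩]
    exact inner_self_nonneg (𝕜 := ℂ)

theorem eq_formOperator (h : IsFactor T a) {D : Submodule ℂ H} (hD : T.domain = D)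
    {t : D →ₗ⋆[ℂ] D →ₗ[ℂ] ℂ}
    (ht : ∀ x y : T.domain, ⟪T x, T y⟫_ℂ = t ⟨x, hD.le x.2⟩ ⟨y, hD.le y.2⟩) :
    a = formOperator D t := by
  subst hD
  refine LinearPMap.eq_of_eq_graph (Submodule.ext ?_)
  rintro ⟨x, z⟩
  rw [h.mem_graph_iff, mem_formOperator_graph _ _ h.dense_domain]
  exact exists_congr fun hx => forall_congr' fun y => by rw [ht ⟨x, hx⟩ y, eq_comm]

variable [CompleteSpace K]

theorem oneAdd_surjective (h : IsFactor T a) : Function.Surjective (oneAdd a) := by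
  intro z
  obtain ⟨p, hp⟩ := exists_inner_sub_add_inner_sub_eq_zero h.isClosed z 0
  have hpz : ((p : H), z - p) ∈ a.graph := by
    refine h.mem_graph_iff.mpr ⟨p.2, fun y => ?_⟩
    have hpy := hp y
    rwa [zero_sub, inner_neg_left, add_neg_eq_zero] at hpy
  obtain ⟨x, hxp, hx⟩ := a.mem_graph_iff.mp hpz
  exact ⟨x, by rw [oneAdd_apply, hx, hxp, add_sub_cancel]⟩

theorem isPosSelfAdjoint (h : IsFactor T a) : IsPosSelfAdjoint a :=
  h.isPosSymmetric.isPosSelfAdjoint_of_oneAdd_surjective h.oneAdd_surjective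

theorem exists_mem_domain_of_forall_inner_eq (h : IsFactor T a) {x : H} {v : K}
    (hv : ∀ y : a.domain, ⟪v, T ⟨y, h.domain_le y.2⟩⟫_ℂ = ⟪x, a y⟫_ℂ) :
    ∃ hx : x ∈ T.domain, ∀ y : T.domain, ⟪v - T ⟨x, hx⟩, T y⟫_ℂ = 0 := by
  obtain ⟨p, hp⟩ := exists_inner_sub_add_inner_sub_eq_zero h.isClosed x v
  have horth (y : a.domain) : ⟪x - p, oneAdd a y⟫_ℂ = 0 := calc
    ⟪x - p, oneAdd a y⟫_ℂ = ⟪x - p, (y : H)⟫_ℂ + ⟪v - T p, T ⟨y, h.domain_le y.2⟩⟫_ℂ := by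
      rw [oneAdd_apply, inner_add_right, inner_sub_left x _ (a y), inner_sub_left v, hv,
        h.inner_apply']
    _ = 0 := hp ⟨y, h.domain_le y.2⟩
  obtain ⟨y, hy⟩ := h.oneAdd_surjective (x - p)
  obtain rfl : x = p := by
    rw [← sub_eq_zero, ← inner_self_eq_zero (𝕜 := ℂ)]
    simpa only [hy] using horth y
  exact ⟨p.2, fun y => by simpa only [sub_self, inner_zero_left, zero_add] using hp y⟩

end IsFactor

end Factor

section Resolvent

variable [CompleteSpace H]

namespace IsPosSelfAdjoint

theorem orthogonal_range_oneAdd (ha : IsPosSelfAdjoint a) : (LinearMap.range (oneAdd a))ᗮ = ⊥ := by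
  rw [Submodule.eq_bot_iff]
  intro y hy
  have hgraph : (y, -y) ∈ a.graph := by
    rw [← LinearPMap.isSelfAdjoint_def.mp ha.selfAdjoint,
      mem_adjoint_graph_iff ha.selfAdjoint.dense_domain]
    intro x
    have horth : ⟪y, oneAdd a x⟫_ℂ = 0 := (Submodule.mem_orthogonal' _ _).mp hy _ ⟨x, rfl⟩
    rw [oneAdd_apply, inner_add_right] at horth
    rw [inner_neg_left]
    exact neg_eq_of_add_eq_zero_right horth
  obtain ⟨x, rfl, hx⟩ := a.mem_graph_iff.mp hgraph
  have hnonneg := ha.nonneg x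
  rw [hx, inner_neg_left, Complex.neg_re, neg_nonneg] at hnonneg
  exact re_inner_self_nonpos (𝕜 := ℂ).mp hnonneg

theorem oneAdd_surjective (ha : IsPosSelfAdjoint a) : Function.Surjective (oneAdd a) := by
  have hcl := ha.isPosSymmetric.isClosed_range_oneAdd ha.selfAdjoint.isClosed
  rw [← LinearMap.range_eq_top, ← hcl.submodule_topologicalClosure_eq,
    Submodule.topologicalClosure_eq_top_iff, ha.orthogonal_range_oneAdd]

/-- The resolvent `(1 + a)⁻¹` of a positive selfadjoint operator, as a bounded operator. -/
def resolvent (ha : IsPosSelfAdjoint a) : H →L[ℂ] H :=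
  let e := LinearEquiv.ofBijective (oneAdd a)
    ⟨ha.isPosSymmetric.oneAdd_injective, ha.oneAdd_surjective⟩
  (a.domain.subtype ∘ₗ e.symm.toLinearMap).mkContinuous 1 fun z => by
    rw [one_mul]
    exact (ha.isPosSymmetric.norm_le_norm_oneAdd (e.symm z)).trans_eq
      (congrArg norm (e.apply_symm_apply z))

theorem resolvent_oneAdd (ha : IsPosSelfAdjoint a) (x : a.domain) :
    ha.resolvent (oneAdd a x) = x :=
  congrArg Subtype.val (LinearEquiv.ofBijective_symm_apply_apply (oneAdd a) x)

theorem resolvent_injective (ha : IsPosSelfAdjoint a) : Function.Injective ha.resolvent := by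
  intro z w hzw
  obtain ⟨x, rfl⟩ := ha.oneAdd_surjective z
  obtain ⟨y, rfl⟩ := ha.oneAdd_surjective w
  rw [ha.resolvent_oneAdd, ha.resolvent_oneAdd] at hzw
  rw [Subtype.ext hzw]

theorem resolvent_add_eq_iff (ha : IsPosSelfAdjoint a) {x z : H} :
    ha.resolvent (x + z) = x ↔ (x, z) ∈ a.graph := by
  rw [LinearPMap.mem_graph_iff]
  constructor
  · intro h
    obtain ⟨y, hy⟩ := ha.oneAdd_surjective (x + z)
    obtain rfl : (y : H) = x := by rw [← ha.resolvent_oneAdd, hy, h]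
    exact ⟨y, rfl, add_left_cancel hy⟩
  · rintro ⟨x, rfl, rfl⟩
    exact ha.resolvent_oneAdd x

theorem resolvent_nonneg (ha : IsPosSelfAdjoint a) : 0 ≤ ha.resolvent := by
  rw [ContinuousLinearMap.nonneg_iff_isPositive, ContinuousLinearMap.isPositive_def]
  refine ⟨fun z w => ?_, fun z => ?_⟩ <;> obtain ⟨x, rfl⟩ := ha.oneAdd_surjective z
  · obtain ⟨y, rfl⟩ := ha.oneAdd_surjective w
    change ⟪ha.resolvent _, _⟫_ℂ = ⟪_, ha.resolvent _⟫_ℂ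
    rw [ha.resolvent_oneAdd, ha.resolvent_oneAdd, oneAdd_apply, oneAdd_apply, inner_add_left,
      inner_add_right, ha.isPosSymmetric.symm]
  · change 0 ≤ (⟪ha.resolvent _, _⟫_ℂ).re
    rw [ha.resolvent_oneAdd, oneAdd_apply, inner_add_right, ← ha.isPosSymmetric.symm,
      Complex.add_re]
    exact add_nonneg (inner_self_nonneg (𝕜 := ℂ)) (ha.nonneg x)

theorem resolvent_le_one (ha : IsPosSelfAdjoint a) : ha.resolvent ≤ 1 := by
  have hsymm := ((ContinuousLinearMap.nonneg_iff_isPositive _).mp ha.resolvent_nonneg).isSymmetric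
  rw [ContinuousLinearMap.le_def, ContinuousLinearMap.isPositive_def]
  refine ⟨LinearMap.IsSymmetric.id.sub hsymm, fun z => ?_⟩
  obtain ⟨x, rfl⟩ := ha.oneAdd_surjective z
  change 0 ≤ (⟪oneAdd a x - ha.resolvent _, _⟫_ℂ).re
  rw [ha.resolvent_oneAdd, oneAdd_apply, add_sub_cancel_left, inner_add_right, Complex.add_re]
  exact add_nonneg (ha.nonneg x) (inner_self_nonneg (𝕜 := ℂ))

end IsPosSelfAdjoint

end Resolvent

section Quotient

section Module

variable {R E F G : Type*} [Ring R] [AddCommGroup E] [Module R E] [AddCommGroup F] [Module R F]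
  [AddCommGroup G] [Module R G]

/-- The operator `T S⁻¹` with domain `ran S`, mapping `S x` to `T x`; it serves to construct
`a^{1/2}` as a quotient of bounded operators. Unless `ker S ≤ ker T`, its values are junk. -/
def quotientOp (T : E →ₗ[R] G) (S : E →ₗ[R] F) : F →ₗ.[R] G :=
  (LinearMap.range (S.prod T)).toLinearPMap

theorem mem_quotientOp_graph {T : E →ₗ[R] G} {S : E →ₗ[R] F}
    (hST : LinearMap.ker S ≤ LinearMap.ker T) {p : F} {q : G} :
    (p, q) ∈ (quotientOp T S).graph ↔ ∃ x, S x = p ∧ T x = q := by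
  rw [quotientOp, Submodule.toLinearPMap_graph_eq]
  · exact exists_congr fun x => Prod.ext_iff
  · rintro _ ⟨x, rfl⟩ hx
    exact hST hx

theorem quotientOp_domain (T : E →ₗ[R] G) (S : E →ₗ[R] F) :
    (quotientOp T S).domain = LinearMap.range S := by
  change (LinearMap.range (S.prod T)).map (LinearMap.fst R F G) = LinearMap.range S
  rw [← LinearMap.range_comp, LinearMap.fst_prod]

end Module

theorem mem_adjoint_quotientOp_graph {𝕜 E F G : Type*} [RCLike 𝕜] [NormedAddCommGroup E]
    [InnerProductSpace 𝕜 E] [CompleteSpace E] [NormedAddCommGroup F] [InnerProductSpace 𝕜 F]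
    [CompleteSpace F] [NormedAddCommGroup G] [InnerProductSpace 𝕜 G] [CompleteSpace G]
    {T : E →L[𝕜] G} {S : E →L[𝕜] F} (hS : DenseRange S) (hST : S.ker ≤ T.ker) {y : G} {z : F} :
    (y, z) ∈ (quotientOp T.toLinearMap S.toLinearMap)†.graph ↔
      ContinuousLinearMap.adjoint S z = ContinuousLinearMap.adjoint T y := by
  have hdense : Dense ((quotientOp T.toLinearMap S.toLinearMap).domain : Set F) := by
    rw [quotientOp_domain]
    exact hS
  rw [mem_adjoint_graph_iff hdense]
  constructor
  · intro h
    refine ext_inner_right 𝕜 fun x => ?_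
    obtain ⟨p, hp, hTp⟩ := (LinearPMap.mem_graph_iff _).mp
      ((mem_quotientOp_graph hST).mpr ⟨x, rfl, rfl⟩)
    rw [ContinuousLinearMap.adjoint_inner_left, ContinuousLinearMap.adjoint_inner_left]
    simpa only [hp, hTp] using! h p
  · intro h p
    obtain ⟨x, hx, hTx⟩ := (mem_quotientOp_graph hST).mp (LinearPMap.mem_graph _ p)
    have hxx := congrArg (fun v => ⟪v, x⟫_𝕜) h
    rw [← hx, ← hTx]
    simpa only [ContinuousLinearMap.adjoint_inner_left] using! hxx

theorem isSelfAdjoint_quotientOp {𝕜 E : Type*} [RCLike 𝕜] [NormedAddCommGroup E]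
    [InnerProductSpace 𝕜 E] [CompleteSpace E] {S T : E →L[𝕜] E} (hS : IsSelfAdjoint S)
    (hT : IsSelfAdjoint T) (hcomm : Commute S T) (hone : S * S + T * T = 1)
    (hinj : Function.Injective S) :
    IsSelfAdjoint (quotientOp T.toLinearMap S.toLinearMap) := by
  have hker : S.ker = ⊥ := LinearMap.ker_eq_bot.mpr hinj
  have hST : S.ker ≤ T.ker := hker.le.trans bot_le
  have hdense : DenseRange S := by
    change Dense (S.range : Set E)
    rw [Submodule.dense_iff_topologicalClosure_eq_top, Submodule.topologicalClosure_eq_top_iff,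
      ContinuousLinearMap.orthogonal_range, hS.adjoint_eq, hker]
  have hcomm' (x : E) : S (T x) = T (S x) := DFunLike.congr_fun hcomm.eq x
  have hone' (x : E) : S (S x) + T (T x) = x := DFunLike.congr_fun hone x
  refine LinearPMap.isSelfAdjoint_def.mpr (LinearPMap.eq_of_eq_graph (Submodule.ext ?_))
  rintro ⟨y, z⟩
  rw [mem_adjoint_quotientOp_graph hdense hST, mem_quotientOp_graph hST, hS.adjoint_eq,
    hT.adjoint_eq]
  constructor
  · intro h
    refine ⟨S y + T z, ?_, ?_⟩
    · change S (S y + T z) = y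
      rw [map_add, hcomm', h, hone']
    · change T (S y + T z) = z
      rw [map_add, ← hcomm', ← h, hone']
  · rintro ⟨x, rfl, rfl⟩
    exact hcomm' x

variable {S T : H →L[ℂ] H}

theorem mem_opComp_quotientOp_self_graph (hcomm : Commute S T) (hone : S * S + T * T = 1)
    (hinj : Function.Injective S) {x z : H} :
    (x, z) ∈ (opComp (quotientOp T.toLinearMap S.toLinearMap)
      (quotientOp T.toLinearMap S.toLinearMap)).graph ↔ (S * S) (x + z) = x := by
  have hST : S.ker ≤ T.ker := (LinearMap.ker_eq_bot.mpr hinj).le.trans bot_le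
  have hcomm' (x : H) : S (T x) = T (S x) := DFunLike.congr_fun hcomm.eq x
  have hone' (x : H) : S (S x) + T (T x) = x := DFunLike.congr_fun hone x
  simp only [mem_opComp_graph, mem_quotientOp_graph hST, ContinuousLinearMap.coe_coe,
    mul_apply_eq_comp]
  constructor
  · rintro ⟨_, ⟨u, rfl, rfl⟩, v, hv, rfl⟩
    rw [map_add S (S u), hcomm' v, hv, hone']
  · intro h
    refine ⟨T (S (x + z)), ⟨S (x + z), h, rfl⟩, T (x + z), hcomm' _, ?_⟩
    have hsum := hone' (x + z)
    rw [h] at hsum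
    exact add_left_cancel hsum

theorem isPosSelfAdjoint_quotientOp [CompleteSpace H] (hS : 0 ≤ S) (hT : 0 ≤ T)
    (hcomm : Commute S T) (hone : S * S + T * T = 1) (hinj : Function.Injective S) :
    IsPosSelfAdjoint (quotientOp T.toLinearMap S.toLinearMap) where
  selfAdjoint := isSelfAdjoint_quotientOp hS.isSelfAdjoint hT.isSelfAdjoint hcomm hone hinj
  nonneg p := by
    have hST : S.ker ≤ T.ker := (LinearMap.ker_eq_bot.mpr hinj).le.trans bot_le
    obtain ⟨x, hx, hTx⟩ := (mem_quotientOp_graph hST).mp (LinearPMap.mem_graph _ p)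
    have hpos := (ContinuousLinearMap.nonneg_iff_isPositive _).mp (hcomm.mul_nonneg hS hT)
    have hsymm := ((ContinuousLinearMap.nonneg_iff_isPositive _).mp hS).inner_left_eq_inner_right
    rw [← hx, ← hTx]
    change 0 ≤ (⟪T x, S x⟫_ℂ).re
    rw [← hsymm]
    exact hpos.re_inner_nonneg_left x

end Quotient

section Sqrt

variable [CompleteSpace H]

theorem commute_sqrt {A : Type*} [CStarAlgebra A] [PartialOrder A] [StarOrderedRing A] {S T : A}
    (h : Commute S T) : Commute (CFC.sqrt S) (CFC.sqrt T) := by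
  unfold CFC.sqrt
  exact ((h.cfcₙ_nnreal _).symm.cfcₙ_nnreal _).symm

theorem IsPosSelfAdjoint.exists_isPosSqrt (ha : IsPosSelfAdjoint a) : ∃ s, IsPosSqrt s a := by
  let R := ha.resolvent
  let S := CFC.sqrt R
  let T := CFC.sqrt (1 - R)
  have hSS : S * S = R := CFC.sqrt_mul_sqrt_self R ha.resolvent_nonneg
  have hTT : T * T = 1 - R :=
    CFC.sqrt_mul_sqrt_self (1 - R) (sub_nonneg.mpr ha.resolvent_le_one)
  have hcomm : Commute S T :=
    commute_sqrt ((Commute.one_right R).sub_right (Commute.refl R))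
  have hone : S * S + T * T = 1 := by rw [hSS, hTT, add_sub_cancel]
  have hinj : Function.Injective S := by
    refine Function.Injective.of_comp (f := S) ?_
    change Function.Injective (S * S)
    rw [hSS]
    exact ha.resolvent_injective
  refine ⟨quotientOp T.toLinearMap S.toLinearMap, isPosSelfAdjoint_quotientOp
    (CFC.sqrt_nonneg R) (CFC.sqrt_nonneg (1 - R)) hcomm hone hinj,
    LinearPMap.eq_of_eq_graph (Submodule.ext ?_)⟩
  rintro ⟨x, z⟩
  rw [mem_opComp_quotientOp_self_graph hcomm hone hinj, hSS, ha.resolvent_add_eq_iff]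

theorem IsPosSelfAdjoint.isPosSqrt_opSqrt (ha : IsPosSelfAdjoint a) : IsPosSqrt (opSqrt a) a := by
  have h := ha.exists_isPosSqrt
  rw [opSqrt, dif_pos h]
  exact h.choose_spec

theorem IsPosSqrt.isFactor {s : H →ₗ.[ℂ] H} (hs : IsPosSqrt s a) : IsFactor s a where
  isClosed := hs.posSelfAdjoint.selfAdjoint.isClosed
  dense_domain := hs.posSelfAdjoint.selfAdjoint.dense_domain
  adjoint_comp_self := by
    rw [LinearPMap.isSelfAdjoint_def.mp hs.posSelfAdjoint.selfAdjoint, hs.sq]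

end Sqrt

section HilbertRan

theorem Ran.of_surjective (ha : IsAdmissible a) : Function.Surjective (Ran.of ha) := fun p =>
  ⟨Ran.preim ha p, Ran.incl_injective ha (Ran.map_preim ha p)⟩

namespace HilbertRan

/-- The element `a x` of `ran a`, in the completion `H_a`. -/
def of (ha : IsAdmissible a) : a.domain →ₗ[ℂ] HilbertRan a ha :=
  (UniformSpace.Completion.toComplₗᵢ (𝕜 := ℂ) (E := Ran a ha)).toLinearMap ∘ₗ Ran.of ha

theorem denseRange_of (ha : IsAdmissible a) : DenseRange (of ha) :=
  UniformSpace.Completion.denseRange_coe.comp (Ran.of_surjective ha).denseRange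
    (UniformSpace.Completion.continuous_coe _)

theorem inner_of (ha : IsAdmissible a) (x y : a.domain) :
    ⟪of ha x, of ha y⟫_ℂ = ⟪a x, (y : H)⟫_ℂ :=
  (UniformSpace.Completion.inner_coe _ _).trans (Ran.inner_of ha x y)

end HilbertRan

/-- The vector `u` of `H_a` represents the functional `a y ↦ (x, a y)` on `ran a`, that is, `u` is
the image of `x` under the adjoint of the inclusion of `ran a` into `H`. -/
def Represents (ha : IsAdmissible a) (x : H) (u : HilbertRan a ha) : Prop :=
  ∀ y : a.domain, ⟪u, HilbertRan.of ha y⟫_ℂ = ⟪x, a y⟫_ℂ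

namespace IsFactor

variable [CompleteSpace H] {T : H →ₗ.[ℂ] K} (h : IsFactor T a)

/-- The map `x ↦ T x` on `dom a`, which induces `IsFactor.isometry` on `ran a`. -/
def restrict : a.domain →ₗ[ℂ] K := T.toFun ∘ₗ Submodule.inclusion h.domain_le

variable (ha : IsAdmissible a)

theorem norm_restrict (x : a.domain) : ‖h.restrict x‖ = ‖HilbertRan.of ha x‖ := by
  rw [norm_eq_sqrt_re_inner (𝕜 := ℂ), norm_eq_sqrt_re_inner (𝕜 := ℂ), HilbertRan.inner_of]
  exact congrArg _ (congrArg _ (h.inner_apply x ⟨x, h.domain_le x.2⟩).symm)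

variable [CompleteSpace K]

/-- The isometric extension of `a x ↦ T x` to the Hilbert space `H_a`. -/
def isometry : HilbertRan a ha →ₗᵢ[ℂ] K where
  toLinearMap := (h.restrict.extendOfNorm (HilbertRan.of ha)).toLinearMap
  norm_map' u := by
    refine (HilbertRan.denseRange_of ha).induction_on u
      (isClosed_eq (by fun_prop) (by fun_prop)) fun x => ?_
    rw [ContinuousLinearMap.coe_coe, LinearMap.extendOfNorm_eq (HilbertRan.denseRange_of ha)
      ⟨1, fun y => by rw [one_mul, h.norm_restrict ha]⟩, h.norm_restrict ha]

theorem isometry_of (x : a.domain) :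
    h.isometry ha (HilbertRan.of ha x) = T ⟨x, h.domain_le x.2⟩ :=
  LinearMap.extendOfNorm_eq (HilbertRan.denseRange_of ha)
    ⟨1, fun y => by rw [one_mul, h.norm_restrict ha]⟩ x

theorem exists_represents (h : IsFactor T a) (x : T.domain) : ∃ u, Represents ha (x : H) u := by
  refine ⟨ContinuousLinearMap.adjoint (h.isometry ha).toContinuousLinearMap (T x), fun y => ?_⟩
  rw [ContinuousLinearMap.adjoint_inner_left, LinearIsometry.coe_toContinuousLinearMap,
    h.isometry_of, h.inner_apply']

variable {ha}

theorem isometry_eq_of_represents (h : IsFactor T a) {x : H} {u : HilbertRan a ha}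
    (hu : Represents ha x u) : ∃ hx : x ∈ T.domain, h.isometry ha u = T ⟨x, hx⟩ := by
  obtain ⟨hx, horth⟩ := h.exists_mem_domain_of_forall_inner_eq (v := h.isometry ha u) fun y => by
    rw [← h.isometry_of ha, LinearIsometry.inner_map_map, hu y]
  refine ⟨hx, ?_⟩
  have horth_range : ⟪h.isometry ha u - T ⟨x, hx⟩, h.isometry ha u⟫_ℂ = 0 := by
    refine (HilbertRan.denseRange_of ha).induction_on
      (p := fun w => ⟪h.isometry ha u - T ⟨x, hx⟩, h.isometry ha w⟫_ℂ = 0) u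
      (isClosed_eq (by fun_prop) (by fun_prop)) fun y => ?_
    rw [h.isometry_of]
    exact horth _
  rw [← sub_eq_zero, ← inner_self_eq_zero (𝕜 := ℂ), inner_sub_right, horth_range, horth, sub_zero]

theorem inner_eq_of_represents (h : IsFactor T a) {x y : T.domain} {u v : HilbertRan a ha}
    (hu : Represents ha (x : H) u) (hv : Represents ha (y : H) v) : ⟪u, v⟫_ℂ = ⟪T x, T y⟫_ℂ := by
  obtain ⟨_, hux⟩ := h.isometry_eq_of_represents hu
  obtain ⟨_, hvy⟩ := h.isometry_eq_of_represents hv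
  rw [← (h.isometry ha).inner_map_map, hux, hvy]

end IsFactor

end HilbertRan

section AdjointJ

variable (ha : IsAdmissible a) (hb : IsAdmissible b)

theorem dense_opJ_domain :
    Dense ((opJ ha hb).domain : Set (WithLp 2 (HilbertRan a ha × HilbertRan b hb))) := by
  have hrange : DenseRange (sumEmb ha hb) :=
    (WithLp.linearEquiv 2 ℂ (HilbertRan a ha × HilbertRan b hb)).symm.surjective.denseRange.comp
      (UniformSpace.Completion.denseRange_coe.prodMap UniformSpace.Completion.denseRange_coe)
      (WithLp.prod_continuous_toLp 2 _ _)
  rwa [DenseRange, ← LinearMap.coe_range] at hrange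

theorem mem_opJ_adjoint_graph_iff (x : H) (u : WithLp 2 (HilbertRan a ha × HilbertRan b hb)) :
    (x, u) ∈ (opJ ha hb)†.graph ↔ Represents ha x u.fst ∧ Represents hb x u.snd := by
  rw [mem_adjoint_graph_iff (dense_opJ_domain ha hb)]
  constructor
  · intro h
    have hsum (y : a.domain) (z : b.domain) :
        ⟪u.fst, HilbertRan.of ha y⟫_ℂ + ⟪u.snd, HilbertRan.of hb z⟫_ℂ = ⟪x, a y + b z⟫_ℂ := by
      rw [← opJ_apply ha hb y z, ← h]
      rfl
    constructor
    · intro y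
      simpa only [map_zero, inner_zero_right, add_zero, LinearPMap.map_zero] using hsum y 0
    · intro z
      simpa only [map_zero, inner_zero_right, zero_add, LinearPMap.map_zero] using hsum 0 z
  · rintro ⟨hu, hv⟩ ⟨_, ⟨p, q⟩, rfl⟩
    obtain ⟨y, rfl⟩ := Ran.of_surjective ha p
    obtain ⟨z, rfl⟩ := Ran.of_surjective hb q
    rw [opJ_apply, inner_add_right, ← hu, ← hv]
    rfl

variable [CompleteSpace H]

theorem isFactor_opJJ (hdense : Dense ((opJ ha hb)†.domain : Set H)) :
    IsFactor (opJ ha hb)† (opJJ ha hb) where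
  isClosed := LinearPMap.adjoint_isClosed (dense_opJ_domain ha hb)
  dense_domain := hdense
  adjoint_comp_self := rfl

variable {ha hb} [CompleteSpace K] {K' : Type*} [NormedAddCommGroup K'] [InnerProductSpace ℂ K']
  [CompleteSpace K'] {S : H →ₗ.[ℂ] K} {T : H →ₗ.[ℂ] K'}

theorem opJ_adjoint_domain (hS : IsFactor S a) (hT : IsFactor T b) :
    (opJ ha hb)†.domain = S.domain ⊓ T.domain := by
  ext x
  constructor
  · intro hx
    obtain ⟨hu, hv⟩ :=
      (mem_opJ_adjoint_graph_iff ha hb _ _).mp ((opJ ha hb)†.mem_graph ⟨x, hx⟩)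
    exact ⟨(hS.isometry_eq_of_represents hu).1, (hT.isometry_eq_of_represents hv).1⟩
  · rintro ⟨hxS, hxT⟩
    obtain ⟨u, hu⟩ := hS.exists_represents ha ⟨x, hxS⟩
    obtain ⟨v, hv⟩ := hT.exists_represents hb ⟨x, hxT⟩
    exact LinearPMap.mem_domain_of_mem_graph
      ((mem_opJ_adjoint_graph_iff ha hb x (WithLp.toLp 2 (u, v))).mpr ⟨hu, hv⟩)

theorem inner_opJ_adjoint (hS : IsFactor S a) (hT : IsFactor T b)
    (x y : (opJ ha hb)†.domain) :
    ⟪(opJ ha hb)† x, (opJ ha hb)† y⟫_ℂ =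
      ⟪S ⟨x, ((opJ_adjoint_domain hS hT).le x.2).1⟩,
        S ⟨y, ((opJ_adjoint_domain hS hT).le y.2).1⟩⟫_ℂ +
      ⟪T ⟨x, ((opJ_adjoint_domain hS hT).le x.2).2⟩,
        T ⟨y, ((opJ_adjoint_domain hS hT).le y.2).2⟩⟫_ℂ := by
  obtain ⟨hxa, hxb⟩ := (mem_opJ_adjoint_graph_iff ha hb _ _).mp ((opJ ha hb)†.mem_graph x)
  obtain ⟨hya, hyb⟩ := (mem_opJ_adjoint_graph_iff ha hb _ _).mp ((opJ ha hb)†.mem_graph y)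
  rw [WithLp.prod_inner_apply]
  exact congrArg₂ (· + ·) (hS.inner_eq_of_represents hxa hya) (hT.inner_eq_of_represents hxb hyb)

end AdjointJ

end

end FormSum

open FormSum in
theorem theorem3 {H : Type*} [NormedAddCommGroup H] [InnerProductSpace ℂ H] [CompleteSpace H]
    (a b : H →ₗ.[ℂ] H) (ha : FormSum.IsPosSelfAdjoint a) (hb : FormSum.IsPosSelfAdjoint b)
    (hdense : Dense (((FormSum.opSqrt a).domain ⊓ (FormSum.opSqrt b).domain : Submodule ℂ H) :
      Set H)) :
    FormSum.opJJ ha.isAdmissible hb.isAdmissible = FormSum.formSum a b ∧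
      FormSum.IsPosSelfAdjoint (FormSum.formSum a b) := by
  have hs := ha.isPosSqrt_opSqrt.isFactor
  have ht := hb.isPosSqrt_opSqrt.isFactor
  have hdom := opJ_adjoint_domain (ha := ha.isAdmissible) (hb := hb.isAdmissible) hs ht
  have hJ := isFactor_opJJ ha.isAdmissible hb.isAdmissible (hdom ▸ hdense)
  have heq : opJJ ha.isAdmissible hb.isAdmissible = formSum a b :=
    hJ.eq_formOperator hdom (inner_opJ_adjoint hs ht)
  exact ⟨heq, heq ▸ hJ.isPosSelfAdjoint⟩
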